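/- Consider the discrete-time closed loop formed by an uncertain process $x_p[k+1]=A^\Delta x_p[k]+B^\Delta\tilde u[k]$, $y[k]=C^\Delta x_p[k]$, $y_p[k]=C_J^\Delta x_p[k]+D_J^\Delta\tilde u[k]$, a controller $z[k+1]=A_cz[k]+B_c\tilde y[k]$, $u[k]=C_cz[k]+D_c\tilde y[k]$, and a detector $s[k+1]=A_es[k]+B_eu[k]+K_e\tilde y[k]$, $y_r[k]=C_es[k]+D_eu[k]+E_e\tilde y[k]$, with injected data $\tilde u[k]=u[k]+B_aa[k]$, $\tilde y[k]=y[k]+D_aa[k]$. All matrices are real; the process matrices are nominal matrices plus perturbations depending on $\delta\in\Omega$ and vanishing at $\delta=0$, where $\Omega\subset\mathbb R^q$ is closed and bounded and contains $0$. Fix a sample $\delta_i\in\Omega$ and write the closed loop at $\delta_i$, with state $x=(x_p,z,s)$, as $$x[k+1]=A_{cl,i}x[k]+B_{cl,i}a[k],\quad y_p[k]=C_{p,i}x[k]+D_{p,i}a[k],\quad y_r[k]=C_{r,i}x[k]+D_{r,i}a[k],\quad x[0]=0.$$ Assume it is stable, i.e. all eigenvalues of $A_{cl,i}$ lie in the open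 unit disc. For an arbitrary signal $a:\{0,1,2,\dots\}\to\mathbb R^{n_a}$ let $\|y\|_{\ell_2}^2=\sum_{k\ge0}y[k]^Ty[k]\in[0,\infty]$, write $x[\infty]=0$ for $\lim_{k\to\infty}x[k]=0$, and define the impact $X(a,\delta_i)=\|y_p\|_{\ell_2}^2$ if $\|y_r\|_{\ell_2}^2\le1$ and $x[\infty]=0$, and $X(a,\delta_i)=0$ otherwise. Let $$M(\gamma,\delta_i,P)=\begin{bmatrix}A_{cl,i}^TPA_{cl,i}-P&A_{cl,i}^TPB_{cl,i}\\B_{cl,i}^TPA_{cl,i}&B_{cl,i}^TPB_{cl,i}\end{bmatrix}+\begin{bmatrix}C_{p,i}^T\\D_{p,i}^T\end{bmatrix}\begin{bmatrix}C_{p,i}&D_{p,i}\end{bmatrix}-\gamma\begin{bmatrix}C_{r,i}^T\\D_{r,i}^T\end{bmatrix}\begin{bmatrix}C_{r,i}&D_{r,i}\end{bmatrix}.$$ Then, in $[0,\infty]$ and with $\inf\emptyset=\infty$, $$\sup_aX(a,\delta_i)=\sup_a\left\{\|y_p\|_{\ell_2}^2\;\middle|\;\|y_r\|_{\ell_2}^2\le1,\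 x[0]=0,\ x[\infty]=0\right\}=\inf_{\gamma_i\ge0,\;P_i=P_i^T}\left\{\gamma_i\;\middle|\;M(\gamma_i,\delta_i,P_i)\preceq0\right\}.$$ The feasible set $\{(\gamma_i,P_i)\mid\gamma_i\ge0,\ P_i=P_i^T,\ M(\gamma_i,\delta_i,P_i)\preceq0\}$ of the right-hand problem is convex. If moreover $(A_{cl,i},B_{cl,i})$ is controllable (every state is reached from $0$ in finitely many steps) and the common value is finite, then the infimum is attained, i.e. it is a minimum. -/

import Mathlib

open Matrix Filter Topology
open scoped ENNReal

noncomputable section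

namespace StealthyAttack

/-- Matrices of the process:
`x_p[k+1] = A x_p[k] + B ũ[k]`, `y[k] = C x_p[k]`, `y_p[k] = C_J x_p[k] + D_J ũ[k]`. -/
@[ext]
structure Plant (nx nu nm np : ℕ) where
  A : Matrix (Fin nx) (Fin nx) ℝ
  B : Matrix (Fin nx) (Fin nu) ℝ
  C : Matrix (Fin nm) (Fin nx) ℝ
  CJ : Matrix (Fin np) (Fin nx) ℝ
  DJ : Matrix (Fin np) (Fin nu) ℝ

instance {nx nu nm np : ℕ} : Zero (Plant nx nu nm np) :=
  ⟨⟨0, 0, 0, 0, 0⟩⟩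

instance {nx nu nm np : ℕ} : Add (Plant nx nu nm np) :=
  ⟨fun S T => ⟨S.A + T.A, S.B + T.B, S.C + T.C, S.CJ + T.CJ, S.DJ + T.DJ⟩⟩

/-- A process with parametric uncertainty `δ ∈ Ω`: nominal matrices plus perturbations
(`A + ΔA(δ)`, and likewise for the other matrices) vanishing at zero uncertainty. -/
structure UncertainPlant (q nx nu nm np : ℕ) where
  nominal : Plant nx nu nm np
  perturbation : EuclideanSpace ℝ (Fin q) → Plant nx nu nm np
  Ω : Set (EuclideanSpace ℝ (Fin q))
  isClosed_Ω : IsClosed Ω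
  isBounded_Ω : Bornology.IsBounded Ω
  zero_mem_Ω : 0 ∈ Ω
  perturbation_zero : perturbation 0 = 0

/-- The process matrices at the uncertainty `δ`. -/
def UncertainPlant.at {q nx nu nm np : ℕ} (S : UncertainPlant q nx nu nm np)
    (δ : EuclideanSpace ℝ (Fin q)) : Plant nx nu nm np :=
  S.nominal + S.perturbation δ

/-- Output feedback controller:
`z[k+1] = A_c z[k] + B_c ỹ[k]`, `u[k] = C_c z[k] + D_c ỹ[k]`. -/
structure Controller (nz nu nm : ℕ) where
  Ac : Matrix (Fin nz) (Fin nz) ℝ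
  Bc : Matrix (Fin nz) (Fin nm) ℝ
  Cc : Matrix (Fin nu) (Fin nz) ℝ
  Dc : Matrix (Fin nu) (Fin nm) ℝ

/-- Anomaly detector:
`s[k+1] = A_e s[k] + B_e u[k] + K_e ỹ[k]`, `y_r[k] = C_e s[k] + D_e u[k] + E_e ỹ[k]`. -/
structure Detector (ns nu nm nr : ℕ) where
  Ae : Matrix (Fin ns) (Fin ns) ℝ
  Be : Matrix (Fin ns) (Fin nu) ℝ
  Ke : Matrix (Fin ns) (Fin nm) ℝ
  Ce : Matrix (Fin nr) (Fin ns) ℝ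
  De : Matrix (Fin nr) (Fin nu) ℝ
  Ee : Matrix (Fin nr) (Fin nm) ℝ

/-- Data injection channels: `ũ[k] = u[k] + B_a a[k]`, `ỹ[k] = y[k] + D_a a[k]`. -/
structure AttackChannels (nu nm na : ℕ) where
  Ba : Matrix (Fin nu) (Fin na) ℝ
  Da : Matrix (Fin nm) (Fin na) ℝ

/-- A discrete-time linear time-invariant system with one input and two outputs,
`x[k+1] = A x[k] + B a[k]`, `y_p[k] = C_p x[k] + D_p a[k]`, `y_r[k] = C_r x[k] + D_r a[k]`. -/
structure LTI (n m p r : Type*) where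
  A : Matrix n n ℝ
  B : Matrix n m ℝ
  Cp : Matrix p n ℝ
  Dp : Matrix p m ℝ
  Cr : Matrix r n ℝ
  Dr : Matrix r m ℝ

/-- The closed-loop system under attack, with state `x = (x_p, z, s)`, input the injected data `a`,
and outputs the performance output `y_p` and the residue `y_r`. -/
def closedLoop {nx nz ns nu nm np nr na : ℕ} (S : Plant nx nu nm np) (K : Controller nz nu nm)
    (D : Detector ns nu nm nr) (F : AttackChannels nu nm na) :
    LTI (Fin nx ⊕ (Fin nz ⊕ Fin ns)) (Fin na) (Fin np) (Fin nr) where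
  A := fromRows
    (fromCols (S.A + S.B * K.Dc * S.C) (fromCols (S.B * K.Cc) 0))
    (fromRows
      (fromCols (K.Bc * S.C) (fromCols K.Ac 0))
      (fromCols ((D.Be * K.Dc + D.Ke) * S.C) (fromCols (D.Be * K.Cc) D.Ae)))
  B := fromRows (S.B * F.Ba + S.B * K.Dc * F.Da)
    (fromRows (K.Bc * F.Da) ((D.Be * K.Dc + D.Ke) * F.Da))
  Cp := fromCols (S.CJ + S.DJ * K.Dc * S.C) (fromCols (S.DJ * K.Cc) 0)
  Dp := S.DJ * (K.Dc * F.Da + F.Ba)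
  Cr := fromCols ((D.De * K.Dc + D.Ee) * S.C) (fromCols (D.De * K.Cc) D.Ce)
  Dr := (D.De * K.Dc + D.Ee) * F.Da

/-- Squared `ℓ₂` norm of a signal on `ℕ`, `∑ₖ y[k]ᵀ y[k]`, with values in `[0, ∞]`. -/
def energy {p : Type*} [Fintype p] (y : ℕ → p → ℝ) : ℝ≥0∞ :=
  ∑' k, ENNReal.ofReal (y k ⬝ᵥ y k)

namespace LTI

variable {n m p r : Type*} [Fintype n] [Fintype m] [Fintype p] [Fintype r]

/-- State trajectory from `x[0] = 0` under the input `a`. -/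
def state (G : LTI n m p r) (a : ℕ → m → ℝ) : ℕ → n → ℝ
  | 0 => 0
  | k + 1 => G.A *ᵥ G.state a k + G.B *ᵥ a k

/-- Performance output. -/
def yp (G : LTI n m p r) (a : ℕ → m → ℝ) (k : ℕ) : p → ℝ :=
  G.Cp *ᵥ G.state a k + G.Dp *ᵥ a k

/-- Residue. -/
def yr (G : LTI n m p r) (a : ℕ → m → ℝ) (k : ℕ) : r → ℝ :=
  G.Cr *ᵥ G.state a k + G.Dr *ᵥ a k

/-- Asymptotic stability: all complex eigenvalues of `A` lie in the open unit disc. -/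
def IsStable [DecidableEq n] (G : LTI n m p r) : Prop :=
  ∀ z ∈ spectrum ℂ (G.A.map (algebraMap ℝ ℂ)), ‖z‖ < 1

/-- Controllability of `(A, B)`: every state is reached from the origin in finite time. -/
def IsControllable (G : LTI n m p r) : Prop :=
  ∀ v : n → ℝ, ∃ (a : ℕ → m → ℝ) (N : ℕ), G.state a N = v

/-- The attack `a` is admissible: `‖y_r‖² ≤ 1` and `x[∞] = 0`. -/
def IsStealthy (G : LTI n m p r) (a : ℕ → m → ℝ) : Prop :=
  energy (G.yr a) ≤ 1 ∧ Tendsto (G.state a) atTop (𝓝 0)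

open Classical in
/-- Impact of the attack `a`: `‖y_p‖²` times the indicator of admissibility. -/
def impact (G : LTI n m p r) (a : ℕ → m → ℝ) : ℝ≥0∞ :=
  energy (G.yp a) * (if G.IsStealthy a then 1 else 0)

/-- Worst-case impact `sup_a X(a)`. Every signal `ℕ → ℝ^m` lies in the extended space `ℓ_{2e}`. -/
def worstImpact (G : LTI n m p r) : ℝ≥0∞ :=
  ⨆ a : ℕ → m → ℝ, G.impact a

/-- Optimal value of: maximize `‖y_p‖²` subject to `‖y_r‖² ≤ 1`, `x[0] = 0`, `x[∞] = 0`. -/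
def attackValue (G : LTI n m p r) : ℝ≥0∞ :=
  ⨆ (a : ℕ → m → ℝ) (_ : G.IsStealthy a), energy (G.yp a)

/-- The matrix `M(γ, P)` of the linear matrix inequality. -/
def lmi (G : LTI n m p r) (γ : ℝ) (P : Matrix n n ℝ) : Matrix (n ⊕ m) (n ⊕ m) ℝ :=
  fromBlocks (G.Aᵀ * P * G.A - P) (G.Aᵀ * P * G.B) (G.Bᵀ * P * G.A) (G.Bᵀ * P * G.B)
    + (fromCols G.Cp G.Dp)ᵀ * fromCols G.Cp G.Dp
    - γ • ((fromCols G.Cr G.Dr)ᵀ * fromCols G.Cr G.Dr)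

/-- Feasible set of the semidefinite program: `γ ≥ 0`, `P = Pᵀ`, `M(γ, P) ⪯ 0`. -/
def sdpFeasible (G : LTI n m p r) : Set (ℝ × Matrix n n ℝ) :=
  {w | 0 ≤ w.1 ∧ w.2.IsSymm ∧ (-(G.lmi w.1 w.2)).PosSemidef}

/-- Optimal value of the semidefinite program: infimum of `γ`, equal to `∞` if infeasible. -/
def sdpValue (G : LTI n m p r) : ℝ≥0∞ :=
  ⨅ w ∈ G.sdpFeasible, ENNReal.ofReal w.1

end LTI

end StealthyAttack

end

open StealthyAttack

/-! The argument is dissipativity theory. Negative semidefiniteness of `lmi γ P` says that `xᵀPx`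
drops at each step by at least `‖y_p‖² - γ‖y_r‖²`. Telescoping from `x[0] = 0` to `x[∞] = 0` gives
`‖y_p‖² ≤ γ` for every admissible attack (`energy_yp_le_of_mem_sdpFeasible`); `P` may be indefinite,
so the terminal condition is essential.

Conversely, let the attack value `V` be finite. Stability makes every finitely supported input end
at rest with finite energies, so scaling yields `‖y_p‖² ≤ V‖y_r‖²` for these inputs
(`IsStable.tsum_yp_le`). Let `S(x)` be the supremum over such inputs of the accumulated cost `∑
‖y_p‖² - γ‖y_r‖²` from `x`. Where `S` is finite it satisfies the Bellman inequality, and as a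
supremum of a jointly quadratic functional it obeys the parallelogram law, hence `S(x) = xᵀPx` with
`(γ, P)` feasible (`IsStable.exists_mem_sdpFeasible`). Finiteness of `S` holds for every `γ > V`,
which closes the duality gap, and at `γ = V` under controllability, which gives attainment. -/

namespace StealthyAttack

/-! ### Quadratic forms from the parallelogram law -/

section Parallelogram

/-- The additive map `g t = f t - t * f 1` vanishes on the integers, so it is 1-periodic and bounded
everywhere; `g (k • t) = k • g t` then forces `g = 0`. -/
theorem additive_eq_mul_of_bounded {f : ℝ → ℝ} (hadd : ∀ s t, f (s + t) = f s + f t) {C : ℝ}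
    (hC : ∀ t, |t| ≤ 1 → |f t| ≤ C) (t : ℝ) : f t = t * f 1 := by
  let F : ℝ →+ ℝ := AddMonoidHom.mk' f hadd
  let g : ℝ →+ ℝ := F - AddMonoidHom.mulRight (f 1)
  have hg : ∀ t, g t = f t - t * f 1 := fun t => rfl
  have hg1 : g 1 = 0 := by rw [hg]; ring
  have hbound : ∀ t, |g t| ≤ C + |f 1| := by
    intro t
    have hfr : g t = g (Int.fract t) := by
      have h : g (⌊t⌋ : ℝ) = 0 := by
        have := map_zsmul g ⌊t⌋ (1 : ℝ)
        simpa [hg1] using this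
      conv_lhs => rw [← Int.floor_add_fract t]
      rw [map_add, h, zero_add]
    have h1 : |Int.fract t| ≤ 1 := by
      rw [abs_of_nonneg (Int.fract_nonneg t)]; exact (Int.fract_lt_one t).le
    rw [hfr, hg]
    calc |f (Int.fract t) - Int.fract t * f 1|
        ≤ |f (Int.fract t)| + |Int.fract t * f 1| := abs_sub _ _
      _ ≤ C + 1 * |f 1| := by
          rw [abs_mul]
          exact add_le_add (hC _ h1) (mul_le_mul_of_nonneg_right h1 (abs_nonneg _))
      _ = _ := by ring
  have h0 : g t = 0 := by
    by_contra hne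
    obtain ⟨k, hk⟩ := exists_nat_gt ((C + |f 1|) / |g t|)
    have hpos : 0 < |g t| := abs_pos.mpr hne
    rw [div_lt_iff₀ hpos] at hk
    have h := hbound (k • t)
    rw [map_nsmul, nsmul_eq_mul, abs_mul, Nat.abs_cast] at h
    linarith
  rw [hg] at h0
  linarith

/-- The parallelogram law for a real function on an additive group. -/
def ParallelogramLaw {E : Type*} [AddCommGroup E] (S : E → ℝ) : Prop :=
  ∀ x y, S (x + y) + S (x - y) = 2 * S x + 2 * S y

variable {E : Type*} [AddCommGroup E] {S : E → ℝ}

theorem ParallelogramLaw.zero (h : ParallelogramLaw S) : S 0 = 0 := by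
  have := h 0 0
  simp only [add_zero, sub_zero] at this
  linarith

theorem ParallelogramLaw.neg (h : ParallelogramLaw S) (x : E) : S (-x) = S x := by
  have := h 0 x
  simp only [zero_add, zero_sub, h.zero] at this
  linarith

theorem ParallelogramLaw.add_self (h : ParallelogramLaw S) (x : E) : S (x + x) = 4 * S x := by
  have := h x x
  simp only [sub_self, h.zero] at this
  linarith

variable [Module ℝ E]

/-- Jordan–von Neumann: subtracting the laws at `(a + y, b)` and `(a - y, b)` gives `key`, its case
`a = b` gives doubling, and half sum and half difference of `x`, `z` turn `key` into additivity. -/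
theorem ParallelogramLaw.polar_add_left (h : ParallelogramLaw S) (x z y : E) :
    S (x + z + y) - S (x + z - y) = (S (x + y) - S (x - y)) + (S (z + y) - S (z - y)) := by
  have key : ∀ a b : E, S (a + b + y) - S (a + b - y) + (S (a - b + y) - S (a - b - y)) =
      2 * (S (a + y) - S (a - y)) := by
    intro a b
    have h1 := h (a + y) b
    have h2 := h (a - y) b
    rw [show a + y + b = a + b + y by abel, show a + y - b = a - b + y by abel] at h1
    rw [show a - y + b = a + b - y by abel, show a - y - b = a - b - y by abel] at h2
    linarith
  have h2 : ∀ a : E, S (a + a + y) - S (a + a - y) = 2 * (S (a + y) - S (a - y)) := by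
    intro a
    have := key a a
    rw [sub_self, zero_add, zero_sub, h.neg] at this
    linarith
  set p : E := (1 / 2 : ℝ) • (x + z) with hp
  set q : E := (1 / 2 : ℝ) • (x - z) with hq
  have hx : p + q = x := by rw [hp, hq]; module
  have hz : p - q = z := by rw [hp, hq]; module
  have hxz : p + p = x + z := by rw [hp]; module
  have h3 := key p q
  rw [hx, hz] at h3
  rw [← hxz, h2 p]
  linarith

/-- One-sided bounds suffice: `S (t • x + y) + S (t • x - y)` is fixed by the law and bounded for
`|t| ≤ 1`, so a lower bound on each term bounds the other above. -/
theorem ParallelogramLaw.polar_smul_left (h : ParallelogramLaw S)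
    (hhom : ∀ (t : ℝ) x, S (t • x) = t ^ 2 * S x)
    (hlow : ∀ x y : E, ∃ c, ∀ t : ℝ, |t| ≤ 1 → c ≤ S (t • x + y)) (t : ℝ) (x y : E) :
    S (t • x + y) - S (t • x - y) = t * (S (x + y) - S (x - y)) := by
  obtain ⟨c, hc⟩ := hlow x y
  obtain ⟨d, hd⟩ := hlow x (-y)
  have hmain := additive_eq_mul_of_bounded
    (f := fun t => S (t • x + y) - S (t • x - y))
    (fun s t => by
      simp only [add_smul]
      exact h.polar_add_left _ _ _)
    (C := 2 * |S x| + 2 * |S y| + 2 * |c| + 2 * |d|) (fun t ht => by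
      have h1 := h (t • x) y
      have h2 := hc t ht
      have h3 := hd t ht
      rw [← sub_eq_add_neg] at h3
      rw [hhom] at h1
      have h4 : |t ^ 2 * S x| ≤ |S x| := by
        rw [abs_mul, abs_of_nonneg (sq_nonneg t)]
        exact mul_le_of_le_one_left (abs_nonneg _) ((sq_le_one_iff_abs_le_one t).mpr ht)
      have h5 := abs_le.mp h4
      have h6 := neg_abs_le (S y)
      have h7 := le_abs_self (S y)
      have h8 := neg_abs_le c
      have h9 := neg_abs_le d
      have h10 := abs_nonneg c
      have h11 := abs_nonneg d
      rw [abs_le]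
      constructor <;> linarith) t
  simpa using hmain

/-- A homogeneous function satisfying the parallelogram law and bounded below on segments is the
quadratic form of a symmetric matrix. -/
theorem ParallelogramLaw.exists_isSymm {n : Type*} [Fintype n] {S : (n → ℝ) → ℝ}
    (h : ParallelogramLaw S) (hhom : ∀ (t : ℝ) x, S (t • x) = t ^ 2 * S x)
    (hlow : ∀ x y : n → ℝ, ∃ c, ∀ t : ℝ, |t| ≤ 1 → c ≤ S (t • x + y)) :
    ∃ P : Matrix n n ℝ, P.IsSymm ∧ ∀ x, S x = x ⬝ᵥ P *ᵥ x := by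
  classical
  -- Symmetry of the polar form, from evenness of `S`, transfers linearity from the left argument to
  -- the right.
  have hcomm : ∀ x y, S (x + y) - S (x - y) = S (y + x) - S (y - x) := by
    intro x y
    rw [add_comm x y, ← neg_sub y x, h.neg]
  let b : LinearMap.BilinForm ℝ (n → ℝ) := LinearMap.mk₂ ℝ
    (fun x y => (S (x + y) - S (x - y)) / 4)
    (fun x z y => by rw [h.polar_add_left, add_div])
    (fun t x y => by rw [h.polar_smul_left hhom hlow, mul_div_assoc, smul_eq_mul])
    (fun x y z => by simp only [hcomm x]; rw [h.polar_add_left, add_div])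
    (fun t x y => by
      simp only [hcomm x]; rw [h.polar_smul_left hhom hlow, mul_div_assoc, smul_eq_mul])
  have hb : ∀ x y, b x y = (S (x + y) - S (x - y)) / 4 := fun x y => rfl
  refine ⟨LinearMap.BilinForm.toMatrix' b, ?_, fun x => ?_⟩
  · ext i j
    rw [transpose_apply, LinearMap.BilinForm.toMatrix'_apply, LinearMap.BilinForm.toMatrix'_apply,
      hb, hb, hcomm]
  · rw [← Matrix.toBilin'_apply', Matrix.toBilin'_toMatrix', hb, h.add_self, sub_self, h.zero]
    ring

/-- Combining arbitrary `u` for `x` and `v` for `y` gives the inequality `hge`; the reverse one is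
`hge` at `x + y`, `x - y` together with `S (2 • x) = 4 * S x`. -/
theorem parallelogramLaw_iSup {U : Type*} [AddCommGroup U] [Module ℝ U] {J : E → U → ℝ}
    (hpar : ∀ x y u v, J (x + y) (u + v) + J (x - y) (u - v) = 2 * J x u + 2 * J y v)
    (hhom : ∀ (t : ℝ) x u, J (t • x) (t • u) = t ^ 2 * J x u)
    (hbdd : ∀ x, BddAbove (Set.range (J x))) :
    ParallelogramLaw (fun x => ⨆ u, J x u) ∧
      ∀ (t : ℝ) x, ⨆ u, J (t • x) u = t ^ 2 * ⨆ u, J x u := by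
  set S : E → ℝ := fun x => ⨆ u, J x u with hS
  have hle : ∀ x u, J x u ≤ S x := fun x u => le_ciSup (hbdd x) u
  have hge : ∀ x y, 2 * S x + 2 * S y ≤ S (x + y) + S (x - y) := by
    intro x y
    have h1 : ∀ v, S x ≤ (S (x + y) + S (x - y)) / 2 - J y v := by
      intro v
      refine ciSup_le fun u => ?_
      have := hpar x y u v
      have := hle (x + y) (u + v)
      have := hle (x - y) (u - v)
      linarith
    have h2 : S y ≤ (S (x + y) + S (x - y)) / 2 - S x := by
      refine ciSup_le fun v => ?_
      have := h1 v
      linarith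
    linarith
  have hsm : ∀ (t : ℝ) x, t ≠ 0 → S (t • x) ≤ t ^ 2 * S x := by
    intro t x ht
    refine ciSup_le fun u => ?_
    have := hhom t x (t⁻¹ • u)
    rw [smul_inv_smul₀ ht] at this
    rw [this]
    exact mul_le_mul_of_nonneg_left (hle _ _) (sq_nonneg t)
  have hhomS : ∀ (t : ℝ) x, t ≠ 0 → S (t • x) = t ^ 2 * S x := by
    intro t x ht
    refine le_antisymm (hsm t x ht) ?_
    have h1 := hsm t⁻¹ (t • x) (inv_ne_zero ht)
    rw [inv_smul_smul₀ ht, inv_pow] at h1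
    have ht2 : 0 < t ^ 2 := by positivity
    rwa [← div_eq_inv_mul, le_div_iff₀ ht2, mul_comm] at h1
  have h0 : S 0 = 0 := by
    have := hhomS 2 0 two_ne_zero
    rw [smul_zero] at this
    linarith
  refine ⟨fun x y => le_antisymm ?_ (hge x y), fun t x => ?_⟩
  · have h1 := hge (x + y) (x - y)
    rw [show x + y + (x - y) = (2 : ℝ) • x by module,
      show x + y - (x - y) = (2 : ℝ) • y by module, hhomS _ _ two_ne_zero,
      hhomS _ _ two_ne_zero] at h1
    linarith
  · by_cases ht : t = 0
    · subst ht
      rw [zero_smul]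
      simpa using h0
    · exact hhomS t x ht

end Parallelogram

/-! ### Stability and summable signals -/

/-- By Gelfand's formula `‖a ^ k‖ ^ (1 / k)` is eventually below some `r < 1`, so a geometric series
dominates. -/
theorem summable_norm_pow_of_spectralRadius_lt_one {R : Type*} [NormedRing R] [NormedAlgebra ℂ R]
    [CompleteSpace R] {a : R} (h : spectralRadius ℂ a < 1) : Summable fun k : ℕ => ‖a ^ k‖ := by
  obtain ⟨r, hr, hr1⟩ := ENNReal.lt_iff_exists_nnreal_btwn.mp h
  have hr1' : r < 1 := by exact_mod_cast hr1
  have hev := (spectrum.pow_nnnorm_pow_one_div_tendsto_nhds_spectralRadius a).eventually_lt_const hr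
  refine Summable.of_norm_bounded_eventually_nat (g := fun k => (r : ℝ) ^ k)
    (summable_geometric_of_lt_one r.2 (by exact_mod_cast hr1')) ?_
  filter_upwards [hev, eventually_gt_atTop 0] with k hk hk0
  have hk0' : (k : ℝ) ≠ 0 := by exact_mod_cast hk0.ne'
  have h1 : ((‖a ^ k‖₊ : ℝ≥0∞) ^ (1 / k : ℝ)) ^ (k : ℝ) ≤ (r : ℝ≥0∞) ^ (k : ℝ) :=
    ENNReal.rpow_le_rpow hk.le (Nat.cast_nonneg k)
  rw [← ENNReal.rpow_mul, one_div_mul_cancel hk0', ENNReal.rpow_one, ENNReal.rpow_natCast] at h1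
  rw [norm_norm]
  exact_mod_cast h1

section Norm
attribute [local instance] Matrix.linftyOpNormedRing Matrix.linftyOpNormedAlgebra

theorem summable_matrix_pow_apply {n : Type*} [Fintype n] [DecidableEq n] {A : Matrix n n ℝ}
    (h : ∀ z ∈ spectrum ℂ (A.map (algebraMap ℝ ℂ)), ‖z‖ < 1) (i j : n) :
    Summable fun k : ℕ => (A ^ k) i j := by
  have : Nonempty n := ⟨i⟩
  set M := A.map (algebraMap ℝ ℂ) with hM
  have hρ : spectralRadius ℂ M < (1 : NNReal) :=
    spectrum.spectralRadius_lt_of_forall_lt M fun z hz => h z hz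
  refine Summable.of_norm_bounded (summable_norm_pow_of_spectralRadius_lt_one hρ) fun k => ?_
  have h1 : (M ^ k) i j = ((A ^ k) i j : ℂ) := by
    have : M ^ k = (A ^ k).map (algebraMap ℝ ℂ) := by
      rw [hM, ← RingHom.mapMatrix_apply, ← map_pow, RingHom.mapMatrix_apply]
    rw [this]; rfl
  have h2 := Matrix.linfty_opNorm_mulVec (M ^ k) (Pi.single j 1)
  have h3 := norm_le_pi_norm ((M ^ k) *ᵥ Pi.single j 1) i
  rw [Matrix.mulVec_single_one, Matrix.col_apply, h1, Complex.norm_real] at h3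
  refine h3.trans ?_
  have h4 : ‖(Pi.single j 1 : n → ℂ)‖ = 1 := by rw [Pi.norm_single, norm_one]
  rwa [Matrix.mulVec_single_one, h4, mul_one] at h2

end Norm

theorem summable_mulVec {m n : Type*} [Fintype n] (C : Matrix m n ℝ) {x : ℕ → n → ℝ}
    (hx : Summable x) : Summable fun k => C *ᵥ x k := by
  rw [Pi.summable] at hx ⊢
  exact fun i => summable_sum fun j _ => (hx j).mul_left (C i j)

theorem summable_dotProduct_self {n : Type*} [Fintype n] {x : ℕ → n → ℝ} (hx : Summable x) :
    Summable fun k => x k ⬝ᵥ x k := by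
  rw [Pi.summable] at hx
  refine summable_sum fun i _ => ?_
  refine Summable.of_norm_bounded_eventually_nat (hx i).abs ?_
  -- Once the entries are below 1 in absolute value, their squares are dominated by their absolute
  -- values.
  have h1 := (hx i).abs.tendsto_atTop_zero.eventually_lt_const one_pos
  filter_upwards [h1] with k hk
  rw [norm_mul, Real.norm_eq_abs]
  exact mul_le_of_le_one_left (abs_nonneg _) hk.le

theorem zero_le_dotProduct_self {n : Type*} [Fintype n] (x : n → ℝ) : 0 ≤ x ⬝ᵥ x :=
  Finset.sum_nonneg fun i _ => mul_self_nonneg (x i)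

theorem energy_eq_ofReal_tsum {p : Type*} [Fintype p] {y : ℕ → p → ℝ}
    (hy : Summable fun k => y k ⬝ᵥ y k) : energy y = ENNReal.ofReal (∑' k, y k ⬝ᵥ y k) :=
  (ENNReal.ofReal_tsum_of_nonneg (fun k => zero_le_dotProduct_self (y k)) hy).symm

/-- Signals that vanish from some time on. -/
def finiteSignals (m : Type*) : Submodule ℝ (ℕ → m → ℝ) where
  carrier := {a | ∀ᶠ k in atTop, a k = 0}
  add_mem' := by
    intro a b ha hb
    filter_upwards [ha, hb] with k h1 h2
    rw [Pi.add_apply, h1, h2, add_zero]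
  zero_mem' := Eventually.of_forall fun _ => rfl
  smul_mem' := by
    intro c a ha
    filter_upwards [ha] with k h1
    rw [Pi.smul_apply, h1, smul_zero]

theorem summable_of_mem_finiteSignals {m : Type*} {a : ℕ → m → ℝ} (ha : a ∈ finiteSignals m) :
    Summable a := by
  obtain ⟨N, hN⟩ := eventually_atTop.mp (show ∀ᶠ k in atTop, a k = 0 from ha)
  exact summable_of_ne_finset_zero (s := Finset.range N) fun k hk =>
    hN k (by simpa using hk)

theorem dotProduct_gram_fromCols_mulVec {m n q : Type*} [Fintype m] [Fintype n] [Fintype q]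
    (C : Matrix q n ℝ) (D : Matrix q m ℝ) (x : n → ℝ) (u : m → ℝ) :
    Sum.elim x u ⬝ᵥ ((fromCols C D)ᵀ * fromCols C D) *ᵥ Sum.elim x u =
      (C *ᵥ x + D *ᵥ u) ⬝ᵥ (C *ᵥ x + D *ᵥ u) := by
  rw [← mulVec_mulVec, dotProduct_mulVec, vecMul_transpose, fromCols_mulVec_sumElim]

theorem dotProduct_transpose_mul_mul_mulVec {k l n : Type*} [Fintype k] [Fintype l] [Fintype n]
    (E : Matrix n k ℝ) (P : Matrix n n ℝ) (F : Matrix n l ℝ) (v : k → ℝ) (w : l → ℝ) :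
    v ⬝ᵥ (Eᵀ * P * F) *ᵥ w = (E *ᵥ v) ⬝ᵥ P *ᵥ (F *ᵥ w) := by
  rw [← mulVec_mulVec, ← mulVec_mulVec, dotProduct_mulVec, vecMul_transpose]

/-! ### Trajectories from an arbitrary initial state -/

namespace LTI

theorem isSymm_lmi {n m p r : Type*} [Fintype n] [Fintype p] [Fintype r] (G : LTI n m p r) (γ : ℝ) {P : Matrix n n ℝ} (hP : P.IsSymm) :
    (G.lmi γ P).IsSymm := by
  have hP' : Pᵀ = P := hP
  simp only [lmi, Matrix.IsSymm, transpose_sub, transpose_add, transpose_smul, transpose_mul,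
    transpose_transpose, fromBlocks_transpose, hP', Matrix.mul_assoc]

variable {n m p r : Type*} [Fintype n] [Fintype m]

/-- State trajectory from `x[0] = x` under the input `a`. -/
def stateFrom (G : LTI n m p r) (x : n → ℝ) (a : ℕ → m → ℝ) : ℕ → n → ℝ
  | 0 => x
  | k + 1 => G.A *ᵥ G.stateFrom x a k + G.B *ᵥ a k

/-- Performance output from the initial state `x`. -/
def ypFrom (G : LTI n m p r) (x : n → ℝ) (a : ℕ → m → ℝ) (k : ℕ) : p → ℝ :=
  G.Cp *ᵥ G.stateFrom x a k + G.Dp *ᵥ a k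

/-- Residue from the initial state `x`. -/
def yrFrom (G : LTI n m p r) (x : n → ℝ) (a : ℕ → m → ℝ) (k : ℕ) : r → ℝ :=
  G.Cr *ᵥ G.stateFrom x a k + G.Dr *ᵥ a k

theorem stateFrom_zero_eq_state (G : LTI n m p r) (a : ℕ → m → ℝ) : G.stateFrom 0 a = G.state a := by
  funext k
  induction k with
  | zero => rfl
  | succ k ih => rw [stateFrom, ih, state]

theorem ypFrom_zero_eq_yp (G : LTI n m p r) (a : ℕ → m → ℝ) : G.ypFrom 0 a = G.yp a := by
  funext k
  rw [ypFrom, stateFrom_zero_eq_state, yp]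

theorem yrFrom_zero_eq_yr (G : LTI n m p r) (a : ℕ → m → ℝ) : G.yrFrom 0 a = G.yr a := by
  funext k
  rw [yrFrom, stateFrom_zero_eq_state, yr]

theorem stateFrom_add (G : LTI n m p r) (x y : n → ℝ) (a b : ℕ → m → ℝ) :
    G.stateFrom (x + y) (a + b) = G.stateFrom x a + G.stateFrom y b := by
  funext k
  induction k with
  | zero => rfl
  | succ k ih =>
    simp only [stateFrom, Pi.add_apply, ih, mulVec_add]
    abel

theorem stateFrom_smul (G : LTI n m p r) (t : ℝ) (x : n → ℝ) (a : ℕ → m → ℝ) :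
    G.stateFrom (t • x) (t • a) = t • G.stateFrom x a := by
  funext k
  induction k with
  | zero => rfl
  | succ k ih =>
    simp only [stateFrom, Pi.smul_apply, ih, mulVec_smul, smul_add]

theorem ypFrom_add (G : LTI n m p r) (x y : n → ℝ) (a b : ℕ → m → ℝ) :
    G.ypFrom (x + y) (a + b) = G.ypFrom x a + G.ypFrom y b := by
  funext k
  simp only [ypFrom, stateFrom_add, Pi.add_apply, mulVec_add]
  abel

theorem yrFrom_add (G : LTI n m p r) (x y : n → ℝ) (a b : ℕ → m → ℝ) :
    G.yrFrom (x + y) (a + b) = G.yrFrom x a + G.yrFrom y b := by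
  funext k
  simp only [yrFrom, stateFrom_add, Pi.add_apply, mulVec_add]
  abel

theorem ypFrom_smul (G : LTI n m p r) (t : ℝ) (x : n → ℝ) (a : ℕ → m → ℝ) :
    G.ypFrom (t • x) (t • a) = t • G.ypFrom x a := by
  funext k
  simp only [ypFrom, stateFrom_smul, Pi.smul_apply, mulVec_smul, smul_add]

theorem yrFrom_smul (G : LTI n m p r) (t : ℝ) (x : n → ℝ) (a : ℕ → m → ℝ) :
    G.yrFrom (t • x) (t • a) = t • G.yrFrom x a := by
  funext k
  simp only [yrFrom, stateFrom_smul, Pi.smul_apply, mulVec_smul, smul_add]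

theorem stateFrom_shift (G : LTI n m p r) (x : n → ℝ) (a : ℕ → m → ℝ) (N k : ℕ) :
    G.stateFrom x a (k + N) = G.stateFrom (G.stateFrom x a N) (fun j => a (j + N)) k := by
  induction k with
  | zero => rw [zero_add, stateFrom]
  | succ k ih => rw [show k + 1 + N = (k + N) + 1 by ring, stateFrom, ih, stateFrom]

theorem stateFrom_congr (G : LTI n m p r) (x : n → ℝ) {a b : ℕ → m → ℝ} {N : ℕ}
    (h : ∀ k < N, a k = b k) : ∀ k ≤ N, G.stateFrom x a k = G.stateFrom x b k := by
  intro k hk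
  induction k with
  | zero => rfl
  | succ k ih => rw [stateFrom, stateFrom, ih (Nat.le_of_succ_le hk), h k hk]

theorem stateFrom_zero_input [DecidableEq n] (G : LTI n m p r) (x : n → ℝ) (k : ℕ) :
    G.stateFrom x 0 k = G.A ^ k *ᵥ x := by
  induction k with
  | zero => simp [stateFrom]
  | succ k ih => simp [stateFrom, ih, pow_succ']

theorem IsStable.summable_stateFrom [DecidableEq n] {G : LTI n m p r} (h : G.IsStable) (x : n → ℝ)
    {a : ℕ → m → ℝ} (ha : a ∈ finiteSignals m) : Summable (G.stateFrom x a) := by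
  obtain ⟨N, hN⟩ := eventually_atTop.mp (show ∀ᶠ k in atTop, a k = 0 from ha)
  rw [← summable_nat_add_iff N]
  have h0 : (fun j => a (j + N)) = 0 := funext fun j => hN _ (Nat.le_add_left _ _)
  simp only [stateFrom_shift, h0, stateFrom_zero_input]
  rw [Pi.summable]
  exact fun i => summable_sum fun j _ => (summable_matrix_pow_apply h i j).mul_right _

theorem IsStable.summable_ypFrom [Fintype p] [DecidableEq n] {G : LTI n m p r} (h : G.IsStable) (x : n → ℝ)
    {a : ℕ → m → ℝ} (ha : a ∈ finiteSignals m) :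
    Summable fun k => G.ypFrom x a k ⬝ᵥ G.ypFrom x a k :=
  summable_dotProduct_self ((summable_mulVec _ (h.summable_stateFrom x ha)).add
    (summable_mulVec _ (summable_of_mem_finiteSignals ha)))

theorem IsStable.summable_yrFrom [Fintype r] [DecidableEq n] {G : LTI n m p r} (h : G.IsStable) (x : n → ℝ)
    {a : ℕ → m → ℝ} (ha : a ∈ finiteSignals m) :
    Summable fun k => G.yrFrom x a k ⬝ᵥ G.yrFrom x a k :=
  summable_dotProduct_self ((summable_mulVec _ (h.summable_stateFrom x ha)).add
    (summable_mulVec _ (summable_of_mem_finiteSignals ha)))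

/-! ### The matrix inequality as a dissipation inequality -/

variable [Fintype p] [Fintype r]

/-- Instantaneous cost `‖y_p‖² - γ ‖y_r‖²`. -/
def stageCost (G : LTI n m p r) (γ : ℝ) (x : n → ℝ) (u : m → ℝ) : ℝ :=
  (G.Cp *ᵥ x + G.Dp *ᵥ u) ⬝ᵥ (G.Cp *ᵥ x + G.Dp *ᵥ u)
    - γ * ((G.Cr *ᵥ x + G.Dr *ᵥ u) ⬝ᵥ (G.Cr *ᵥ x + G.Dr *ᵥ u))

theorem dotProduct_lmi_mulVec (G : LTI n m p r) (γ : ℝ) (P : Matrix n n ℝ) (x : n → ℝ)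
    (u : m → ℝ) :
    Sum.elim x u ⬝ᵥ G.lmi γ P *ᵥ Sum.elim x u =
      (G.A *ᵥ x + G.B *ᵥ u) ⬝ᵥ P *ᵥ (G.A *ᵥ x + G.B *ᵥ u) - x ⬝ᵥ P *ᵥ x
        + G.stageCost γ x u := by
  rw [lmi, sub_mulVec, add_mulVec, dotProduct_sub, dotProduct_add, smul_mulVec, dotProduct_smul,
    dotProduct_gram_fromCols_mulVec, dotProduct_gram_fromCols_mulVec, fromBlocks_mulVec, sumElim_dotProduct_sumElim]
  simp only [Sum.elim_comp_inl, Sum.elim_comp_inr, sub_mulVec, dotProduct_add, dotProduct_sub,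
    dotProduct_transpose_mul_mul_mulVec,
    mulVec_add, add_dotProduct, stageCost, smul_eq_mul]
  ring

/-- The matrix inequality is a dissipation inequality with storage function `xᵀ P x`. -/
theorem mem_sdpFeasible_iff (G : LTI n m p r) (γ : ℝ) (P : Matrix n n ℝ) :
    (γ, P) ∈ G.sdpFeasible ↔ 0 ≤ γ ∧ P.IsSymm ∧ ∀ x u,
      (G.A *ᵥ x + G.B *ᵥ u) ⬝ᵥ P *ᵥ (G.A *ᵥ x + G.B *ᵥ u) + G.stageCost γ x u
        ≤ x ⬝ᵥ P *ᵥ x := by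
  refine and_congr_right fun _ => and_congr_right fun hP => ?_
  have hH : (-(G.lmi γ P)).IsHermitian := by
    rw [Matrix.IsHermitian, conjTranspose_eq_transpose_of_trivial, transpose_neg,
      (G.isSymm_lmi γ hP : (G.lmi γ P)ᵀ = _)]
  rw [posSemidef_iff_dotProduct_mulVec]
  refine (and_iff_right hH).trans ?_
  have hval : ∀ x u, star (Sum.elim x u) ⬝ᵥ (-(G.lmi γ P)) *ᵥ Sum.elim x u =
      -((G.A *ᵥ x + G.B *ᵥ u) ⬝ᵥ P *ᵥ (G.A *ᵥ x + G.B *ᵥ u) - x ⬝ᵥ P *ᵥ x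
        + G.stageCost γ x u) := by
    intro x u
    rw [star_trivial, neg_mulVec, dotProduct_neg, dotProduct_lmi_mulVec]
  constructor
  · intro h x u
    have := h (Sum.elim x u)
    rw [hval] at this
    linarith
  · intro h z
    rw [← Sum.elim_comp_inl_inr z, hval]
    have := h (z ∘ Sum.inl) (z ∘ Sum.inr)
    linarith

/-- For fixed `x` and `u` the dissipation inequality is affine in `(γ, P)`. -/
theorem convex_sdpFeasible (G : LTI n m p r) : Convex ℝ G.sdpFeasible := by
  rintro ⟨γ₁, P₁⟩ h₁ ⟨γ₂, P₂⟩ h₂ s t hs ht hst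
  rw [mem_sdpFeasible_iff] at h₁ h₂
  obtain ⟨hγ₁, hP₁, h₁⟩ := h₁
  obtain ⟨hγ₂, hP₂, h₂⟩ := h₂
  rw [Prod.smul_mk, Prod.smul_mk, Prod.mk_add_mk, mem_sdpFeasible_iff]
  refine ⟨by simp only [smul_eq_mul]; positivity, (hP₁.smul s).add (hP₂.smul t), fun x u => ?_⟩
  have e₁ := mul_le_mul_of_nonneg_left (h₁ x u) hs
  have e₂ := mul_le_mul_of_nonneg_left (h₂ x u) ht
  simp only [add_mulVec, smul_mulVec, dotProduct_add, dotProduct_smul, smul_eq_mul, stageCost]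
    at e₁ e₂ ⊢
  obtain rfl : t = 1 - s := by linarith
  linarith

end LTI

/-! ### Accumulated cost and available storage -/

theorem dotProduct_self_parallelogram {n : Type*} [Fintype n] (x y : n → ℝ) :
    (x + y) ⬝ᵥ (x + y) + (x - y) ⬝ᵥ (x - y) = 2 * (x ⬝ᵥ x) + 2 * (y ⬝ᵥ y) := by
  simp only [add_dotProduct, dotProduct_add, sub_dotProduct, dotProduct_sub]
  ring

/-- Young's inequality for the squared Euclidean norm of a sum. -/
theorem dotProduct_self_add_le {n : Type*} [Fintype n] (x y : n → ℝ) {ε : ℝ} (hε : 0 < ε) :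
    (x + y) ⬝ᵥ (x + y) ≤ (1 + ε) * (x ⬝ᵥ x) + (1 + ε⁻¹) * (y ⬝ᵥ y) := by
  have h := zero_le_dotProduct_self (ε • x - y)
  have e : (x + y) ⬝ᵥ (x + y) = (1 + ε) * (x ⬝ᵥ x) + (1 + ε⁻¹) * (y ⬝ᵥ y)
      - ε⁻¹ * ((ε • x - y) ⬝ᵥ (ε • x - y)) := by
    simp only [add_dotProduct, dotProduct_add, sub_dotProduct, dotProduct_sub, smul_dotProduct,
      dotProduct_smul, smul_eq_mul, dotProduct_comm y x]
    field_simp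
    ring
  rw [e]
  have := mul_nonneg (inv_nonneg.mpr hε.le) h
  linarith

theorem le_dotProduct_self_add {n : Type*} [Fintype n] (x y : n → ℝ) {ε : ℝ} (hε : 0 < ε) :
    (1 - ε) * (x ⬝ᵥ x) + (1 - ε⁻¹) * (y ⬝ᵥ y) ≤ (x + y) ⬝ᵥ (x + y) := by
  have h := zero_le_dotProduct_self (ε • x + y)
  have e : (x + y) ⬝ᵥ (x + y) = (1 - ε) * (x ⬝ᵥ x) + (1 - ε⁻¹) * (y ⬝ᵥ y)
      + ε⁻¹ * ((ε • x + y) ⬝ᵥ (ε • x + y)) := by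
    simp only [add_dotProduct, dotProduct_add, smul_dotProduct,
      dotProduct_smul, smul_eq_mul, dotProduct_comm y x]
    field_simp
    ring
  rw [e]
  have := mul_nonneg (inv_nonneg.mpr hε.le) h
  linarith

namespace LTI

variable {n m p r : Type*} [Fintype n] [Fintype m] [Fintype p] [Fintype r]

/-- Accumulated cost `∑ₖ ‖y_p[k]‖² - γ ‖y_r[k]‖²` from the initial state `x`. -/
noncomputable def cost (G : LTI n m p r) (γ : ℝ) (x : n → ℝ) (a : ℕ → m → ℝ) : ℝ :=
  ∑' k, G.stageCost γ (G.stateFrom x a k) (a k)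

theorem stageCost_parallelogram (G : LTI n m p r) (γ : ℝ) (x y : n → ℝ) (u v : m → ℝ) :
    G.stageCost γ (x + y) (u + v) + G.stageCost γ (x - y) (u - v) =
      2 * G.stageCost γ x u + 2 * G.stageCost γ y v := by
  have hp := dotProduct_self_parallelogram (G.Cp *ᵥ x + G.Dp *ᵥ u) (G.Cp *ᵥ y + G.Dp *ᵥ v)
  have hr := dotProduct_self_parallelogram (G.Cr *ᵥ x + G.Dr *ᵥ u) (G.Cr *ᵥ y + G.Dr *ᵥ v)
  simp only [stageCost, mulVec_add, mulVec_sub]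
  rw [add_add_add_comm (G.Cp *ᵥ x), add_add_add_comm (G.Cr *ᵥ x), ← add_sub_add_comm (G.Cp *ᵥ x),
    ← add_sub_add_comm (G.Cr *ᵥ x)]
  linear_combination hp - γ * hr

theorem stageCost_smul (G : LTI n m p r) (γ t : ℝ) (x : n → ℝ) (u : m → ℝ) :
    G.stageCost γ (t • x) (t • u) = t ^ 2 * G.stageCost γ x u := by
  simp only [stageCost, mulVec_smul, ← smul_add, smul_dotProduct, dotProduct_smul, smul_eq_mul]
  ring

/-- No summability is needed: a real factor passes through `tsum` even when the series diverges and
the sum is 0 by default. -/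
theorem cost_smul (G : LTI n m p r) (γ t : ℝ) (x : n → ℝ) (a : ℕ → m → ℝ) :
    G.cost γ (t • x) (t • a) = t ^ 2 * G.cost γ x a := by
  unfold cost
  rw [← tsum_mul_left]
  refine tsum_congr fun k => ?_
  rw [stateFrom_smul]
  exact G.stageCost_smul γ t _ _

/-- The input that follows `a` before time `N` and then starts `b`. -/
def splice {m : Type*} (a : ℕ → m → ℝ) (N : ℕ) (b : ℕ → m → ℝ) (k : ℕ) : m → ℝ :=
  if k < N then a k else b (k - N)

theorem splice_mem_finiteSignals {m : Type*} (a : ℕ → m → ℝ) (N : ℕ) {b : ℕ → m → ℝ}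
    (hb : b ∈ finiteSignals m) : splice a N b ∈ finiteSignals m := by
  obtain ⟨M, hM⟩ := eventually_atTop.mp (show ∀ᶠ k in atTop, b k = 0 from hb)
  refine eventually_atTop.mpr ⟨M + N, fun k hk => ?_⟩
  rw [splice, if_neg (by omega)]
  exact hM _ (by omega)

section Stable

variable [DecidableEq n] {G : LTI n m p r}

theorem IsStable.summable_stageCost (h : G.IsStable) (γ : ℝ) (x : n → ℝ) {a : ℕ → m → ℝ}
    (ha : a ∈ finiteSignals m) :
    Summable fun k => G.stageCost γ (G.stateFrom x a k) (a k) :=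
  (h.summable_ypFrom x ha).sub ((h.summable_yrFrom x ha).mul_left γ)

theorem IsStable.cost_eq (h : G.IsStable) (γ : ℝ) (x : n → ℝ) {a : ℕ → m → ℝ}
    (ha : a ∈ finiteSignals m) :
    G.cost γ x a = ∑' k, G.ypFrom x a k ⬝ᵥ G.ypFrom x a k
      - γ * ∑' k, G.yrFrom x a k ⬝ᵥ G.yrFrom x a k := by
  rw [← tsum_mul_left, ← (h.summable_ypFrom x ha).tsum_sub ((h.summable_yrFrom x ha).mul_left γ)]
  rfl

theorem IsStable.cost_parallelogram (h : G.IsStable) (γ : ℝ) (x y : n → ℝ) {a b : ℕ → m → ℝ}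
    (ha : a ∈ finiteSignals m) (hb : b ∈ finiteSignals m) :
    G.cost γ (x + y) (a + b) + G.cost γ (x - y) (a - b) =
      2 * G.cost γ x a + 2 * G.cost γ y b := by
  have hsub : G.stateFrom (x - y) (a - b) = G.stateFrom x a - G.stateFrom y b := by
    rw [eq_sub_iff_add_eq, ← stateFrom_add, sub_add_cancel, sub_add_cancel]
  unfold cost
  rw [← (h.summable_stageCost γ _ (add_mem ha hb)).tsum_add
      (h.summable_stageCost γ _ (sub_mem ha hb)), ← tsum_mul_left, ← tsum_mul_left,
    ← ((h.summable_stageCost γ x ha).mul_left 2).tsum_add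
      ((h.summable_stageCost γ y hb).mul_left 2)]
  refine tsum_congr fun k => ?_
  rw [stateFrom_add, hsub]
  exact G.stageCost_parallelogram γ _ _ _ _

/-- The dynamic programming identity, from time invariance. With `N = 1` it gives the Bellman
inequality; with `a` steering 0 to a given state it bounds the cost from that state. -/
theorem IsStable.cost_splice (h : G.IsStable) (γ : ℝ) (x : n → ℝ) (a : ℕ → m → ℝ) (N : ℕ)
    {b : ℕ → m → ℝ} (hb : b ∈ finiteSignals m) :
    G.cost γ x (splice a N b) = ∑ k ∈ Finset.range N, G.stageCost γ (G.stateFrom x a k) (a k)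
      + G.cost γ (G.stateFrom x a N) b := by
  have hin : ∀ k < N, splice a N b k = a k := fun k hk => if_pos hk
  have hst := G.stateFrom_congr x hin
  have hshift : (fun j => splice a N b (j + N)) = b := by
    funext j
    rw [splice, if_neg (by omega), Nat.add_sub_cancel]
  rw [cost, ← (h.summable_stageCost γ x (splice_mem_finiteSignals a N hb)).sum_add_tsum_nat_add N]
  congr 1
  · refine Finset.sum_congr rfl fun k hk => ?_
    have hk' := Finset.mem_range.mp hk
    rw [hin k hk', hst k hk'.le]
  · refine tsum_congr fun k => ?_
    rw [stateFrom_shift, hshift, hst N le_rfl, congrFun hshift k]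

/-- If the cost is bounded above from every initial state, then the available storage, the supremum
of the cost over the input, is a quadratic form that solves the matrix inequality. -/
theorem IsStable.exists_mem_sdpFeasible (h : G.IsStable) {γ : ℝ} (hγ : 0 ≤ γ)
    (hbdd : ∀ x, BddAbove (Set.range fun a : finiteSignals m => G.cost γ x a)) :
    ∃ P, (γ, P) ∈ G.sdpFeasible := by
  obtain ⟨hpar, hhom⟩ := parallelogramLaw_iSup (J := fun x (a : finiteSignals m) => G.cost γ x a)
    (fun x y u v => h.cost_parallelogram γ x y u.2 v.2) (fun t x u => G.cost_smul γ t x u) hbdd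
  have hle : ∀ x (a : finiteSignals m), G.cost γ x a ≤ ⨆ a : finiteSignals m, G.cost γ x a :=
    fun x a => le_ciSup (hbdd x) a
  have h0 := (finiteSignals m).zero_mem
  obtain ⟨P, hP, hS⟩ := hpar.exists_isSymm hhom (fun x y => by
    -- The zero input bounds the storage below by `-γ` times the energy of the free residue. That
    -- residue is linear in the state, so the parallelogram law bounds its energy uniformly for `|t|
    -- ≤ 1`.
    refine ⟨-(γ * (2 * ∑' k, G.yrFrom x 0 k ⬝ᵥ G.yrFrom x 0 k
      + 2 * ∑' k, G.yrFrom y 0 k ⬝ᵥ G.yrFrom y 0 k)), fun t ht => le_trans ?_ (hle _ ⟨0, h0⟩)⟩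
    change _ ≤ G.cost γ (t • x + y) 0
    rw [h.cost_eq γ _ h0]
    have h1 : 0 ≤ ∑' k, G.ypFrom (t • x + y) 0 k ⬝ᵥ G.ypFrom (t • x + y) 0 k :=
      tsum_nonneg fun k => zero_le_dotProduct_self _
    have h2 : ∑' k, G.yrFrom (t • x + y) 0 k ⬝ᵥ G.yrFrom (t • x + y) 0 k ≤
        2 * ∑' k, G.yrFrom x 0 k ⬝ᵥ G.yrFrom x 0 k
          + 2 * ∑' k, G.yrFrom y 0 k ⬝ᵥ G.yrFrom y 0 k := by
      rw [← tsum_mul_left, ← tsum_mul_left, ← ((h.summable_yrFrom x h0).mul_left 2).tsum_add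
        ((h.summable_yrFrom y h0).mul_left 2)]
      refine (h.summable_yrFrom _ h0).tsum_le_tsum (fun k => ?_)
        (((h.summable_yrFrom x h0).mul_left 2).add ((h.summable_yrFrom y h0).mul_left 2))
      have e : G.yrFrom (t • x + y) 0 k = t • G.yrFrom x 0 k + G.yrFrom y 0 k := by
        have := congrFun (G.yrFrom_add (t • x) y (t • 0) 0) k
        rwa [smul_zero, add_zero, ← smul_zero (A := ℕ → m → ℝ) t, yrFrom_smul, smul_zero] at this
      rw [e]
      have e1 := dotProduct_self_parallelogram (t • G.yrFrom x 0 k) (G.yrFrom y 0 k)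
      have e0 := zero_le_dotProduct_self (t • G.yrFrom x 0 k - G.yrFrom y 0 k)
      have e3 : (t • G.yrFrom x 0 k) ⬝ᵥ (t • G.yrFrom x 0 k) =
          t ^ 2 * (G.yrFrom x 0 k ⬝ᵥ G.yrFrom x 0 k) := by
        rw [smul_dotProduct, dotProduct_smul, smul_eq_mul, smul_eq_mul, ← mul_assoc, sq]
      rw [e3] at e1
      have e2 : t ^ 2 * (G.yrFrom x 0 k ⬝ᵥ G.yrFrom x 0 k) ≤ G.yrFrom x 0 k ⬝ᵥ G.yrFrom x 0 k :=
        mul_le_of_le_one_left (zero_le_dotProduct_self _) ((sq_le_one_iff_abs_le_one t).mpr ht)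
      linarith
    have h3 := mul_le_mul_of_nonneg_left h2 hγ
    linarith)
  refine ⟨P, (G.mem_sdpFeasible_iff γ P).mpr ⟨hγ, hP, fun x u => ?_⟩⟩
  rw [← hS, ← hS]
  -- Bellman inequality: applying `u` for one step and then `a` is one of the inputs competing from
  -- `x`.
  have hstep : ∀ a : finiteSignals m, G.cost γ (G.A *ᵥ x + G.B *ᵥ u) a ≤
      (⨆ a : finiteSignals m, G.cost γ x a) - G.stageCost γ x u := by
    intro a
    have h1 := h.cost_splice γ x (fun _ => u) 1 a.2
    have h2 := hle x ⟨_, splice_mem_finiteSignals (fun _ => u) 1 a.2⟩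
    rw [Finset.sum_range_one] at h1
    change G.cost γ x (splice (fun _ => u) 1 a) = G.stageCost γ x u
      + G.cost γ (G.A *ᵥ x + G.B *ᵥ u) a at h1
    simp only at h2
    linarith
  have := ciSup_le hstep
  linarith

/-- Outputs split into the response to `a` from 0 and the free response from `x`. Young's inequality
separates the two, and the slack `γ - V` absorbs the cross terms, leaving a bound by free-response
energies, independent of `a`. -/
theorem IsStable.bddAbove_cost_of_lt (h : G.IsStable) {V γ : ℝ} (hV : 0 ≤ V) (hγ : V < γ)
    (hgain : ∀ a ∈ finiteSignals m, ∑' k, G.ypFrom 0 a k ⬝ᵥ G.ypFrom 0 a k ≤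
      V * ∑' k, G.yrFrom 0 a k ⬝ᵥ G.yrFrom 0 a k) (x : n → ℝ) :
    BddAbove (Set.range fun a : finiteSignals m => G.cost γ x a) := by
  have h0 := (finiteSignals m).zero_mem
  have hγ0 : 0 < γ := hV.trans_lt hγ
  -- This `ε` solves `(1 + ε) * V = γ * (1 - ε)`, so the gain bound cancels the forced terms.
  set ε : ℝ := (γ - V) / (γ + V) with hεdef
  have hε : 0 < ε := div_pos (sub_pos.mpr hγ) (by linarith)
  have hbal : (1 + ε) * V = γ * (1 - ε) := by
    have : γ + V ≠ 0 := by linarith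
    rw [hεdef]; field_simp; ring
  refine ⟨(1 + ε⁻¹) * ∑' k, G.ypFrom x 0 k ⬝ᵥ G.ypFrom x 0 k
    - γ * ((1 - ε⁻¹) * ∑' k, G.yrFrom x 0 k ⬝ᵥ G.yrFrom x 0 k), ?_⟩
  rintro _ ⟨⟨a, ha⟩, rfl⟩
  change G.cost γ x a ≤ _
  have hp : ∀ k, G.ypFrom x a k = G.ypFrom 0 a k + G.ypFrom x 0 k := fun k => by
    have := congrFun (G.ypFrom_add 0 x a 0) k
    rwa [zero_add, add_zero] at this
  have hr : ∀ k, G.yrFrom x a k = G.yrFrom 0 a k + G.yrFrom x 0 k := fun k => by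
    have := congrFun (G.yrFrom_add 0 x a 0) k
    rwa [zero_add, add_zero] at this
  have h1 : ∑' k, G.ypFrom x a k ⬝ᵥ G.ypFrom x a k ≤
      (1 + ε) * ∑' k, G.ypFrom 0 a k ⬝ᵥ G.ypFrom 0 a k
        + (1 + ε⁻¹) * ∑' k, G.ypFrom x 0 k ⬝ᵥ G.ypFrom x 0 k := by
    have s1 := (h.summable_ypFrom 0 ha).mul_left (1 + ε)
    have s2 := (h.summable_ypFrom x h0).mul_left (1 + ε⁻¹)
    rw [← tsum_mul_left, ← tsum_mul_left, ← s1.tsum_add s2]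
    refine (h.summable_ypFrom x ha).tsum_le_tsum (fun k => ?_) (s1.add s2)
    rw [hp k]
    exact dotProduct_self_add_le _ _ hε
  have h2 : (1 - ε) * ∑' k, G.yrFrom 0 a k ⬝ᵥ G.yrFrom 0 a k
      + (1 - ε⁻¹) * ∑' k, G.yrFrom x 0 k ⬝ᵥ G.yrFrom x 0 k ≤
        ∑' k, G.yrFrom x a k ⬝ᵥ G.yrFrom x a k := by
    have s1 := (h.summable_yrFrom 0 ha).mul_left (1 - ε)
    have s2 := (h.summable_yrFrom x h0).mul_left (1 - ε⁻¹)
    rw [← tsum_mul_left, ← tsum_mul_left, ← s1.tsum_add s2]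
    refine (s1.add s2).tsum_le_tsum (fun k => ?_) (h.summable_yrFrom x ha)
    rw [hr k]
    exact le_dotProduct_self_add _ _ hε
  rw [h.cost_eq γ x ha]
  have h3 := mul_le_mul_of_nonneg_left (hgain a ha) (by linarith : 0 ≤ 1 + ε)
  have h4 := mul_le_mul_of_nonneg_left h2 hγ0.le
  rw [← mul_assoc, hbal] at h3
  linarith

/-- Without slack in `γ`: steer 0 to `x`, then apply `a`. The total cost from 0 is nonpositive by
the gain bound, so the cost from `x` is at most minus the steering cost, which does not depend on
`a`. -/
theorem IsStable.bddAbove_cost_of_isControllable (h : G.IsStable) (hc : G.IsControllable) {V : ℝ}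
    (hgain : ∀ a ∈ finiteSignals m, ∑' k, G.ypFrom 0 a k ⬝ᵥ G.ypFrom 0 a k ≤
      V * ∑' k, G.yrFrom 0 a k ⬝ᵥ G.yrFrom 0 a k) (x : n → ℝ) :
    BddAbove (Set.range fun a : finiteSignals m => G.cost V x a) := by
  obtain ⟨b, N, hb⟩ := hc x
  rw [← stateFrom_zero_eq_state] at hb
  refine ⟨-∑ k ∈ Finset.range N, G.stageCost V (G.stateFrom 0 b k) (b k), ?_⟩
  rintro _ ⟨⟨a, ha⟩, rfl⟩
  have h1 := h.cost_splice V 0 b N ha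
  have h2 := splice_mem_finiteSignals b N ha
  have h3 := hgain _ h2
  rw [h.cost_eq V 0 h2, hb] at h1
  change G.cost V x a ≤ _
  linarith

end Stable

/-! ### Weak duality -/

theorem worstImpact_eq_attackValue (G : LTI n m p r) : G.worstImpact = G.attackValue := by
  classical
  refine iSup_congr fun a => ?_
  -- An inadmissible attack counts 0 on both sides: `∞ * 0 = 0` in `ℝ≥0∞`, and an empty supremum is
  -- 0.
  by_cases h : G.IsStealthy a <;> simp [impact, h]

theorem energy_yp_le_of_mem_sdpFeasible (G : LTI n m p r) {γ : ℝ} {P : Matrix n n ℝ}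
    (h : (γ, P) ∈ G.sdpFeasible) {a : ℕ → m → ℝ} (ha : G.IsStealthy a) :
    energy (G.yp a) ≤ ENNReal.ofReal γ := by
  obtain ⟨hγ, -, hdiss⟩ := (G.mem_sdpFeasible_iff γ P).mp h
  obtain ⟨hr, hx⟩ := ha
  have hr' : ∀ N, ∑ k ∈ Finset.range N, G.yr a k ⬝ᵥ G.yr a k ≤ 1 := by
    intro N
    have h1 := (ENNReal.sum_le_tsum (Finset.range N)).trans hr
    rw [← ENNReal.ofReal_sum_of_nonneg fun k _ => zero_le_dotProduct_self _] at h1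
    exact ENNReal.ofReal_le_one.mp h1
  have htele : ∀ N, ∑ k ∈ Finset.range N, G.yp a k ⬝ᵥ G.yp a k
      + G.state a N ⬝ᵥ P *ᵥ G.state a N ≤ γ * ∑ k ∈ Finset.range N, G.yr a k ⬝ᵥ G.yr a k := by
    intro N
    induction N with
    | zero => simp [state]
    | succ N ih =>
      rw [Finset.sum_range_succ, Finset.sum_range_succ]
      have h1 := hdiss (G.state a N) (a N)
      change G.state a (N + 1) ⬝ᵥ P *ᵥ G.state a (N + 1) +
        (G.yp a N ⬝ᵥ G.yp a N - γ * (G.yr a N ⬝ᵥ G.yr a N)) ≤ _ at h1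
      linarith
  have hlim : Tendsto (fun N => γ - G.state a N ⬝ᵥ P *ᵥ G.state a N) atTop (𝓝 γ) := by
    have hcont : Continuous fun v : n → ℝ => γ - v ⬝ᵥ P *ᵥ v := by fun_prop
    have := (hcont.tendsto 0).comp hx
    simpa [Function.comp_def] using this
  -- Summability of `‖y_p‖²` is not known here, so the horizon `M` is fixed and the telescoped bound
  -- is used at `N ≥ M` with `N → ∞`.
  refine ENNReal.tsum_le_of_sum_range_le fun M => ?_
  rw [← ENNReal.ofReal_sum_of_nonneg fun k _ => zero_le_dotProduct_self _]
  refine ENNReal.ofReal_le_ofReal (ge_of_tendsto hlim ?_)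
  filter_upwards [eventually_ge_atTop M] with N hN
  have h1 : ∑ k ∈ Finset.range M, G.yp a k ⬝ᵥ G.yp a k ≤
      ∑ k ∈ Finset.range N, G.yp a k ⬝ᵥ G.yp a k :=
    Finset.sum_le_sum_of_subset_of_nonneg (Finset.range_mono hN)
      fun k _ _ => zero_le_dotProduct_self _
  have h2 := mul_le_mul_of_nonneg_left (hr' N) hγ
  have h3 := htele N
  linarith

theorem attackValue_le_sdpValue (G : LTI n m p r) : G.attackValue ≤ G.sdpValue :=
  iSup₂_le fun _ ha => le_iInf₂ fun _ hw => G.energy_yp_le_of_mem_sdpFeasible hw ha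

/-! ### Strong duality and attainment -/

section Stable

variable [DecidableEq n] {G : LTI n m p r}

theorem IsStable.tsum_yp_le (h : G.IsStable) (hfin : G.attackValue ≠ ∞) (a : ℕ → m → ℝ)
    (ha : a ∈ finiteSignals m) : ∑' k, G.ypFrom 0 a k ⬝ᵥ G.ypFrom 0 a k ≤
      G.attackValue.toReal * ∑' k, G.yrFrom 0 a k ⬝ᵥ G.yrFrom 0 a k := by
  set V := G.attackValue.toReal
  set Ep := ∑' k, G.ypFrom 0 a k ⬝ᵥ G.ypFrom 0 a k with hEp
  set Er := ∑' k, G.yrFrom 0 a k ⬝ᵥ G.yrFrom 0 a k with hEr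
  have hEp0 : 0 ≤ Ep := tsum_nonneg fun k => zero_le_dotProduct_self _
  have hEr0 : 0 ≤ Er := tsum_nonneg fun k => zero_le_dotProduct_self _
  have hV0 : 0 ≤ V := ENNReal.toReal_nonneg
  -- Scaling the input by `√s` multiplies both energies by `s`.
  have hscale : ∀ s : ℝ, 0 ≤ s → s * Er ≤ 1 → s * Ep ≤ V := by
    intro s hs hsE
    have hmem : √s • a ∈ finiteSignals m := Submodule.smul_mem _ _ ha
    have hp : energy (G.yp (√s • a)) = ENNReal.ofReal (s * Ep) := by
      rw [← ypFrom_zero_eq_yp, energy_eq_ofReal_tsum (h.summable_ypFrom 0 hmem), hEp,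
        ← tsum_mul_left, ← smul_zero (A := n → ℝ) √s, ypFrom_smul, smul_zero]
      congr 1
      refine tsum_congr fun k => ?_
      rw [Pi.smul_apply, smul_dotProduct, dotProduct_smul, smul_smul, Real.mul_self_sqrt hs,
        smul_eq_mul]
    have hr : energy (G.yr (√s • a)) = ENNReal.ofReal (s * Er) := by
      rw [← yrFrom_zero_eq_yr, energy_eq_ofReal_tsum (h.summable_yrFrom 0 hmem), hEr,
        ← tsum_mul_left, ← smul_zero (A := n → ℝ) √s, yrFrom_smul, smul_zero]
      congr 1
      refine tsum_congr fun k => ?_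
      rw [Pi.smul_apply, smul_dotProduct, dotProduct_smul, smul_smul, Real.mul_self_sqrt hs,
        smul_eq_mul]
    have hst : G.IsStealthy (√s • a) := by
      refine ⟨hr.trans_le (ENNReal.ofReal_le_one.mpr hsE), ?_⟩
      rw [← stateFrom_zero_eq_state]
      exact (h.summable_stateFrom 0 hmem).tendsto_atTop_zero
    have h1 : energy (G.yp (√s • a)) ≤ G.attackValue :=
      le_iSup₂ (f := fun a (_ : G.IsStealthy a) => energy (G.yp a)) _ hst
    rw [hp] at h1
    exact (ENNReal.ofReal_le_iff_le_toReal hfin).mp h1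
  rcases hEr0.eq_or_lt with hz | hpos
  · rw [← hz, mul_zero]
    by_contra! hneg
    -- With zero residue every scaling is admissible; this one would produce impact `V + 1`.
    have h1 := hscale ((V + 1) / Ep) (by positivity) (by rw [← hz]; simp)
    rw [div_mul_cancel₀ _ hneg.ne'] at h1
    linarith
  · have h1 := hscale Er⁻¹ (by positivity) (by rw [inv_mul_cancel₀ hpos.ne'])
    rwa [inv_mul_le_iff₀ hpos, mul_comm] at h1

theorem IsStable.attackValue_eq_sdpValue (h : G.IsStable) : G.attackValue = G.sdpValue := by
  refine le_antisymm G.attackValue_le_sdpValue ?_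
  -- The inequality is trivial for an infinite attack value, so `hlt` may assume finiteness; `γ = V
  -- + ε` then leaves slack for every `ε > 0`.
  refine ENNReal.le_of_forall_pos_le_add fun ε hε hlt => ?_
  have hfin := hlt.ne
  have hV0 : 0 ≤ G.attackValue.toReal := ENNReal.toReal_nonneg
  have hε' : (0 : ℝ) < ε := hε
  obtain ⟨P, hP⟩ := h.exists_mem_sdpFeasible (γ := G.attackValue.toReal + ε) (by linarith)
    (h.bddAbove_cost_of_lt hV0 (by linarith) (h.tsum_yp_le hfin))
  refine (iInf₂_le _ hP).trans_eq ?_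
  rw [ENNReal.ofReal_add hV0 hε'.le, ENNReal.ofReal_toReal hfin, ENNReal.ofReal_coe_nnreal]

theorem IsStable.exists_ofReal_eq_sdpValue (h : G.IsStable) (hc : G.IsControllable)
    (hfin : G.sdpValue ≠ ∞) : ∃ w ∈ G.sdpFeasible, ENNReal.ofReal w.1 = G.sdpValue := by
  rw [← h.attackValue_eq_sdpValue] at hfin ⊢
  obtain ⟨P, hP⟩ := h.exists_mem_sdpFeasible ENNReal.toReal_nonneg
    (h.bddAbove_cost_of_isControllable hc (h.tsum_yp_le hfin))
  exact ⟨_, hP, ENNReal.ofReal_toReal hfin⟩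

end Stable

end LTI

end StealthyAttack

theorem lemma1 {q nx nz ns nu nm np nr na : ℕ}
    (S : UncertainPlant q nx nu nm np) (K : Controller nz nu nm)
    (D : Detector ns nu nm nr) (F : AttackChannels nu nm na)
    (δ : EuclideanSpace ℝ (Fin q)) (hδ : δ ∈ S.Ω)
    (hstable : (closedLoop (S.at δ) K D F).IsStable) :
    (closedLoop (S.at δ) K D F).worstImpact = (closedLoop (S.at δ) K D F).attackValue ∧
    (closedLoop (S.at δ) K D F).attackValue = (closedLoop (S.at δ) K D F).sdpValue ∧
    Convex ℝ (closedLoop (S.at δ) K D F).sdpFeasible ∧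
    ((closedLoop (S.at δ) K D F).IsControllable →
      (closedLoop (S.at δ) K D F).sdpValue ≠ ∞ →
        ∃ w ∈ (closedLoop (S.at δ) K D F).sdpFeasible,
          ENNReal.ofReal w.1 = (closedLoop (S.at δ) K D F).sdpValue) :=
  ⟨LTI.worstImpact_eq_attackValue _, hstable.attackValue_eq_sdpValue, LTI.convex_sdpFeasible _,
    hstable.exists_ofReal_eq_sdpValue⟩
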